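/- Let $(G,P)$ be a quasi-lattice ordered group: $G$ is a group, $P\subseteq G$ a subsemigroup with $P\cap P^{-1}=\{e\}$, and, for the order $p\le q\Leftrightarrow p^{-1}q\in P$, any $p,q\in G$ with a common upper bound in $P$ have a least common upper bound $p\vee q$ in $P$. Let $\Lambda$ be a $P$-graph: a countable category (identified with its set of morphisms, with range and source maps $r,s$, and $\mu\nu$ defined when $s(\mu)=r(\nu)$) with a functor $d:\Lambda\to P$ such that whenever $d(\lambda)=pq$ with $p,q\in P$ there are unique $\mu,\nu\in\Lambda$ with $\lambda=\mu\nu$, $d(\mu)=p$, $d(\nu)=q$. Let $\mathrm{MCE}(\mu,\nu)$ be the set of $\lambda\in\Lambda$ such that $d(\mu)\vee d(\nu)$ exists, $d(\lambda)=d(\mu)\vee d(\nu)$, and $\lambda=\mu\alpha=\nu\beta$ for some $\alpha,\beta\in\Lambda$. Assume that $\Lambda$ is finitely aligned, i.e. every $\mathrm{MCE}(\mu,\nu)$ is finite. For a vertex $v$ write $v\Lambda=\{\mu\in\Lambda: r(\mu)=v\}$; a set $E\subseteq v\Lambda$ is exhaustive if for every $\mu\in v\Lambda$ there is $\lambda\in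 E$ with $\mathrm{MCE}(\mu,\lambda)\neq\emptyset$. A representation of the balanced pairs $\{(\mu,\nu): s(\mu)=s(\nu),\ d(\mu)=d(\nu)\}$ in a (not necessarily unital) $C^*$-algebra $B$ is a map $(\mu,\nu)\mapsto\tau_{\mu,\nu}\in B$ on these pairs with $\tau_{\mu,\nu}^*=\tau_{\nu,\mu}$ and $$\tau_{\mu,\nu}\tau_{\xi,\eta}=\sum_{\nu\alpha=\xi\beta\in\mathrm{MCE}(\nu,\xi)}\tau_{\mu\alpha,\eta\beta}$$ for all balanced pairs $(\mu,\nu)$, $(\xi,\eta)$. Let $\mathcal B(\Lambda)$ be the universal $C^*$-algebra generated by a representation $\omega$ of the balanced pairs, so that each representation $\tau$ induces a $*$-homomorphism $\rho_\tau:\mathcal B(\Lambda)\to C^*(\tau)$ with $\rho_\tau(\omega_{\mu,\nu})=\tau_{\mu,\nu}$, where $C^*(\tau)$ is the $C^*$-algebra generated by the $\tau_{\mu,\nu}$. **Theorem.** Let $\tau$ be a representation of the balanced pairs of $\Lambda$ in a $C^*$-algebra such that $\tau_{\mu,\mu}\neq 0$ for every $\mu\in\Lambda$. Then $\ker(\rho_\tau)$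 is the closed two-sided ideal of $\mathcal B(\Lambda)$ generated by $$\bigcup_{\mu\in\Lambda}\Big\{\prod_{\alpha\in E}(\omega_{\mu,\mu}-\omega_{\mu\alpha,\mu\alpha})\ :\ E\subseteq s(\mu)\Lambda\text{ is finite and exhaustive, and }\prod_{\alpha\in E}(\tau_{\mu,\mu}-\tau_{\mu\alpha,\mu\alpha})=0\Big\}.$$ -/

import Mathlib

open CategoryTheory

open scoped ENNReal

universe w v u

noncomputable section


/-! ### Quasi-lattice ordered groups -/

section QuasiLattice

variable {G : Type*} [Group G]

/-- The left-invariant relation `p ≤ q ↔ p⁻¹ q ∈ P` on `G`. -/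
def LeftLE (P : Submonoid G) (p q : G) : Prop := p⁻¹ * q ∈ P

/-- `r = p ∨ q`: `r` is the least among the common upper bounds of `p` and `q` in `P`. -/
def IsJoin (P : Submonoid G) (p q r : G) : Prop :=
  r ∈ P ∧ LeftLE P p r ∧ LeftLE P q r ∧ ∀ t ∈ P, LeftLE P p t → LeftLE P q t → LeftLE P r t

/-- `(G, P)` is a quasi-lattice ordered group. (A subsemigroup `P` with `P ∩ P⁻¹ = {e}` contains
`e`, so `P` is a submonoid.) -/
class IsQuasiLatticeOrdered (P : Submonoid G) : Prop where
  eq_one_of_inv_mem : ∀ p ∈ P, p⁻¹ ∈ P → p = 1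
  exists_join : ∀ p q : G, (∃ t ∈ P, LeftLE P p t ∧ LeftLE P q t) → ∃ r, IsJoin P p q r

end QuasiLattice

/-! ### Paths, that is, morphisms of a small category -/

/-- A morphism of the category `C`, with its domain (source) and codomain (range). -/
@[ext]
structure Mor (C : Type u) [Category.{v} C] : Type (max u v) where
  dom : C
  cod : C
  hom : dom ⟶ cod

namespace Mor

variable {C : Type u} [Category.{v} C]

/-- The composition `μν = μ ∘ ν`, defined when `r(ν) = s(μ)`. -/
def comp (μ ν : Mor C) (h : ν.cod = μ.dom) : Mor C :=
  ⟨ν.dom, μ.cod, ν.hom ≫ eqToHom h ≫ μ.hom⟩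

/-- The identity morphism at `o`. -/
def ident (o : C) : Mor C := ⟨o, o, 𝟙 o⟩

theorem comp_ident (μ : Mor C) : μ.comp (ident μ.dom) rfl = μ := by
  simp [comp, ident]

end Mor

/-- The set `vΛ` of paths with range `v`. -/
def MorTo {C : Type u} [Category.{v} C] (o : C) : Type (max u v) :=
  {α : Mor C // α.cod = o}

/-! ### `P`-graphs -/

/-- A `P`-graph structure on the category `C`. Composition in the one-object category of `P` is
`f ≫ g = g * f`, so functoriality says `d(μν) = d(μ)d(ν)` where `μν = μ ∘ ν`. -/
structure PGraph {G : Type*} [Group G] (P : Submonoid G) (C : Type u) [Category.{v} C] where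
  degree : C ⥤ SingleObj P
  countable : Countable (Mor C)
  factorisation : ∀ (lam : Mor C) (p q : P), (degree.map lam.hom : P) = p * q →
    ∃! x : Mor C × Mor C, ∃ h : x.2.cod = x.1.dom,
      lam = x.1.comp x.2 h ∧ (degree.map x.1.hom : P) = p ∧ (degree.map x.2.hom : P) = q

namespace PGraph

variable {G : Type*} [Group G] {P : Submonoid G} {C : Type u} [Category.{v} C]

/-- The degree `d(μ) ∈ P` of a path. -/
def deg (Λ : PGraph P C) (μ : Mor C) : P := Λ.degree.map μ.hom

theorem deg_comp (Λ : PGraph P C) (μ ν : Mor C) (h : ν.cod = μ.dom) :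
    Λ.deg (μ.comp ν h) = Λ.deg μ * Λ.deg ν := by
  obtain ⟨a, b, f⟩ := μ
  obtain ⟨c, d, g⟩ := ν
  simp only at h
  subst h
  simp only [deg, Mor.comp, eqToHom_refl, Category.id_comp, Functor.map_comp]
  rfl

theorem comp_inj (Λ : PGraph P C) {μ ν μ' ν' : Mor C} {h : ν.cod = μ.dom} {h' : ν'.cod = μ'.dom}
    (heq : μ.comp ν h = μ'.comp ν' h') (hd : Λ.deg μ = Λ.deg μ') : μ = μ' ∧ ν = ν' := by
  have e : Λ.deg ν = Λ.deg ν' := by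
    have := congrArg Λ.deg heq
    rw [deg_comp, deg_comp, hd] at this
    exact mul_left_cancel this
  have := (Λ.factorisation (μ.comp ν h) _ _ (Λ.deg_comp μ ν h)).unique
    (y₁ := (μ, ν)) (y₂ := (μ', ν')) ⟨h, rfl, rfl, rfl⟩ ⟨h', heq, hd.symm, e.symm⟩
  simpa using this

/-- The set of minimal common extensions of `μ` and `ν`. (Here `d(α)` and `d(β)` are forced, since
`d` is multiplicative.) -/
def MCE (Λ : PGraph P C) (μ ν : Mor C) : Set (Mor C) :=
  {lam | IsJoin P (Λ.deg μ : G) (Λ.deg ν : G) (Λ.deg lam : G) ∧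
    ∃ (α β : Mor C) (hα : α.cod = μ.dom) (hβ : β.cod = ν.dom),
      lam = μ.comp α hα ∧ lam = ν.comp β hβ}

/-- `Λ` is finitely aligned. -/
class FinitelyAligned (Λ : PGraph P C) : Prop where
  finite_MCE : ∀ μ ν : Mor C, (Λ.MCE μ ν).Finite

/-- The subset `E` of `vΛ` is exhaustive. -/
def Exhaustive (Λ : PGraph P C) {o : C} (E : Set (MorTo o)) : Prop :=
  ∀ μ : MorTo o, ∃ lam ∈ E, (Λ.MCE μ.1 lam.1).Nonempty

/-- The pairs `(α, β)` with `να = ξβ ∈ MCE(ν, ξ)`. -/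
@[ext]
structure MinExt (Λ : PGraph P C) (ν ξ : Mor C) : Type (max u v) where
  α : Mor C
  β : Mor C
  hα : α.cod = ν.dom
  hβ : β.cod = ξ.dom
  eq : ν.comp α hα = ξ.comp β hβ
  mem : ν.comp α hα ∈ Λ.MCE ν ξ

instance (Λ : PGraph P C) [Λ.FinitelyAligned] (ν ξ : Mor C) : Finite (Λ.MinExt ν ξ) := by
  have := (FinitelyAligned.finite_MCE (Λ := Λ) ν ξ).to_subtype
  refine Finite.of_injective
    (fun e : Λ.MinExt ν ξ => (⟨ν.comp e.α e.hα, e.mem⟩ : Λ.MCE ν ξ)) fun e f hef => ?_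
  have h1 : ν.comp e.α e.hα = ν.comp f.α f.hα := congrArg Subtype.val hef
  have h2 : ξ.comp e.β e.hβ = ξ.comp f.β f.hβ := by rw [← e.eq, ← f.eq, h1]
  exact MinExt.ext (Λ.comp_inj h1 rfl).2 (Λ.comp_inj h2 rfl).2

/-- The balanced pairs: `(μ, ν)` with `s(μ) = s(ν)` and `d(μ) = d(ν)`. -/
@[ext]
structure Balanced (Λ : PGraph P C) : Type (max u v) where
  fst : Mor C
  snd : Mor C
  source_eq : fst.dom = snd.dom
  deg_eq : Λ.deg fst = Λ.deg snd

namespace Balanced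

variable {Λ : PGraph P C}

/-- The pair `(ν, μ)`. -/
def swap (x : Λ.Balanced) : Λ.Balanced := ⟨x.snd, x.fst, x.source_eq.symm, x.deg_eq.symm⟩

/-- The pair `(μ, μ)`. -/
def diag (Λ : PGraph P C) (μ : Mor C) : Λ.Balanced := ⟨μ, μ, rfl, rfl⟩

/-- For `x = (μ, ν)`, `y = (ξ, η)` and `να = ξβ`, the pair `(μα, ηβ)`. -/
def extend (x y : Λ.Balanced) (e : Λ.MinExt x.snd y.fst) : Λ.Balanced where
  fst := x.fst.comp e.α (e.hα.trans x.source_eq.symm)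
  snd := y.snd.comp e.β (e.hβ.trans y.source_eq)
  source_eq := show e.α.dom = e.β.dom from
    show (x.snd.comp e.α e.hα).dom = (y.fst.comp e.β e.hβ).dom by rw [e.eq]
  deg_eq := by
    have := congrArg Λ.deg e.eq
    rw [deg_comp, deg_comp] at this
    rw [deg_comp, deg_comp, x.deg_eq, ← y.deg_eq, this]

end Balanced

/-! ### Representations of the balanced pairs -/

/-- A representation of the balanced pairs of `Λ` in the `C*`-algebra `B`. For finitely aligned `Λ`
the sum in `mul_eq` is finite. -/
structure Representation (Λ : PGraph P C) (B : Type w) [NonUnitalCStarAlgebra B] where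
  toFun : Λ.Balanced → B
  star_eq : ∀ x, star (toFun x) = toFun x.swap
  mul_eq : ∀ x y, toFun x * toFun y = ∑ᶠ e : Λ.MinExt x.snd y.fst, toFun (x.extend y e)

instance (Λ : PGraph P C) (B : Type w) [NonUnitalCStarAlgebra B] :
    CoeFun (Λ.Representation B) fun _ => Λ.Balanced → B := ⟨Representation.toFun⟩

namespace Representation

variable {Λ : PGraph P C} {B : Type w} [NonUnitalCStarAlgebra B]

theorem swap_mul_self [IsQuasiLatticeOrdered P] (τ : Λ.Representation B) (x : Λ.Balanced) :
    τ x.swap * τ x = τ (Balanced.diag Λ x.snd) := by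
  have key : ∀ e : Λ.MinExt x.fst x.fst,
      e.α = Mor.ident x.fst.dom ∧ e.β = Mor.ident x.fst.dom := by
    intro e
    obtain ⟨-, h1, -, h4⟩ := e.mem.1
    have h5 := h4 _ (Λ.deg x.fst).2 (by simp [LeftLE]) (by simp [LeftLE])
    have h6 : (Λ.deg (x.fst.comp e.α e.hα) : G) = Λ.deg x.fst := by
      have := IsQuasiLatticeOrdered.eq_one_of_inv_mem _ h1 (by simpa [LeftLE] using h5)
      rw [inv_mul_eq_one] at this
      exact this.symm
    have h7 : Λ.deg e.α = 1 := by
      have h8 := Subtype.ext h6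
      rw [deg_comp] at h8
      simpa using h8
    have hid : Λ.deg (Mor.ident e.α.cod) = 1 := by
      exact Λ.degree.map_id _
    have hα : e.α = Mor.ident e.α.cod := by
      have e1 : (Mor.ident e.α.cod).comp e.α rfl = e.α.comp (Mor.ident e.α.dom) rfl := by
        simp [Mor.comp, Mor.ident]
      exact (Λ.comp_inj e1 (by rw [hid, h7])).1.symm
    have hαβ : e.α = e.β := (Λ.comp_inj e.eq rfl).2
    rw [e.hα] at hα
    exact ⟨hα, hαβ ▸ hα⟩
  let e₀ : Λ.MinExt x.fst x.fst :=
    ⟨Mor.ident _, Mor.ident _, rfl, rfl, rfl, by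
      rw [Mor.comp_ident]
      refine ⟨⟨(Λ.deg x.fst).2, by simp [LeftLE], by simp [LeftLE], fun t _ h _ => h⟩,
        _, _, rfl, rfl, (Mor.comp_ident _).symm, (Mor.comp_ident _).symm⟩⟩
  have huniq : ∀ e : Λ.MinExt x.fst x.fst, e = e₀ := fun e =>
    MinExt.ext (key e).1 (key e).2
  rw [τ.mul_eq]
  have h0 := finsum_eq_single (fun e : Λ.MinExt x.swap.snd x.fst => τ (x.swap.extend x e)) e₀
    (fun e he => absurd (huniq e) he)
  rw [h0]
  congr 1
  have hs := x.source_eq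
  ext1
  all_goals
    simp only [Balanced.extend, Balanced.swap, Balanced.diag, e₀, hs]
    exact Mor.comp_ident _

theorem norm_apply_le_one [IsQuasiLatticeOrdered P] (τ : Λ.Representation B) (x : Λ.Balanced) :
    ‖τ x‖ ≤ 1 := by
  have h1 : ‖τ x‖ * ‖τ x‖ = ‖τ (Balanced.diag Λ x.snd)‖ := by
    rw [← CStarRing.norm_star_mul_self, τ.star_eq, swap_mul_self]
  have h2 : ‖τ (Balanced.diag Λ x.snd)‖ * ‖τ (Balanced.diag Λ x.snd)‖ =
      ‖τ (Balanced.diag Λ x.snd)‖ := by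
    rw [← CStarRing.norm_star_mul_self, τ.star_eq, swap_mul_self]
    rfl
  have h3 : ‖τ (Balanced.diag Λ x.snd)‖ ≤ 1 := by
    by_contra h
    nlinarith
  by_contra h
  nlinarith

theorem commute_diag (τ : Λ.Representation B) (μ ν : Mor C) :
    Commute (τ (Balanced.diag Λ μ)) (τ (Balanced.diag Λ ν)) := by
  have hsymm : ∀ (μ ν lam : Mor C), lam ∈ Λ.MCE μ ν → lam ∈ Λ.MCE ν μ := by
    rintro μ ν lam ⟨⟨h1, h2, h3, h4⟩, α, β, hα, hβ, e1, e2⟩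
    exact ⟨⟨h1, h3, h2, fun t ht a b => h4 t ht b a⟩, β, α, hβ, hα, e2, e1⟩
  let φ : Λ.MinExt μ ν ≃ Λ.MinExt ν μ :=
    { toFun := fun e => ⟨e.β, e.α, e.hβ, e.hα, e.eq.symm, hsymm _ _ _ (e.eq ▸ e.mem)⟩
      invFun := fun e => ⟨e.β, e.α, e.hβ, e.hα, e.eq.symm, hsymm _ _ _ (e.eq ▸ e.mem)⟩
      left_inv := fun _ => rfl
      right_inv := fun _ => rfl }
  change _ * _ = _ * _
  rw [τ.mul_eq, τ.mul_eq]
  refine finsum_eq_of_bijective φ φ.bijective fun e => congrArg _ ?_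
  exact Balanced.ext e.eq e.eq.symm

end Representation

/-! ### The universal balanced algebra -/

/-- The `C*`-subalgebra generated by a set. -/
def _root_.cstarGenerated {B : Type*} [NonUnitalCStarAlgebra B] (S : Set B) :
    NonUnitalStarSubalgebra ℂ B :=
  (NonUnitalStarAlgebra.adjoin ℂ S).topologicalClosure

instance _root_.cstarGenerated.isClosed {B : Type*} [NonUnitalCStarAlgebra B] (S : Set B) :
    IsClosed (cstarGenerated S : Set B) :=
  NonUnitalStarSubalgebra.isClosed_topologicalClosure _

theorem _root_.subset_cstarGenerated {B : Type*} [NonUnitalCStarAlgebra B] (S : Set B) :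
    S ⊆ cstarGenerated S :=
  (NonUnitalStarAlgebra.subset_adjoin ℂ S).trans
    (NonUnitalStarSubalgebra.le_topologicalClosure _)

/-- Representations of the balanced pairs of `Λ` in arbitrary `C*`-algebras of a universe. -/
structure SomeRep (Λ : PGraph P C) : Type (max u v (w + 1)) where
  carrier : Type w
  [inst : NonUnitalCStarAlgebra carrier]
  rep : Λ.Representation carrier

attribute [instance] SomeRep.inst

/-- The bounded families `(b_τ)` indexed by all representations `τ`, with the supremum norm. -/
abbrev BigProduct (Λ : PGraph P C) : Type (max u v (w + 1)) :=
  lp (fun i : SomeRep.{w} Λ => i.carrier) ∞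

section Universal

variable [IsQuasiLatticeOrdered P]

/-- The family `(τ_{μ,ν})_τ`. -/
def genProduct (Λ : PGraph P C) (x : Λ.Balanced) : BigProduct.{w} Λ :=
  ⟨fun i => i.rep x, memℓp_infty ⟨1, by
    rintro _ ⟨i, rfl⟩
    exact i.rep.norm_apply_le_one x⟩⟩

/-- The universal balanced algebra `B(Λ)`: the `C*`-algebra generated by the families
`(τ_{μ,ν})_τ`. -/
abbrev BalAlg (Λ : PGraph P C) : Type (max u v (w + 1)) :=
  cstarGenerated (Set.range (genProduct.{w} Λ))

/-- The universal representation `ω` of the balanced pairs in `B(Λ)`. -/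
def omega (Λ : PGraph P C) [Λ.FinitelyAligned] : Λ.Representation (BalAlg.{w} Λ) where
  toFun x := ⟨genProduct Λ x, subset_cstarGenerated _ ⟨x, rfl⟩⟩
  star_eq x := by
    apply Subtype.ext
    apply lp.ext
    funext i
    exact i.rep.star_eq x
  mul_eq x y := by
    have := Fintype.ofFinite (Λ.MinExt x.snd y.fst)
    rw [finsum_eq_sum_of_fintype]
    apply Subtype.ext
    apply lp.ext
    funext i
    have h := i.rep.mul_eq x y
    rw [finsum_eq_sum_of_fintype] at h
    rw [AddSubmonoidClass.coe_finsetSum, lp.coeFn_sum, Finset.sum_apply]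
    exact h

/-- Evaluation of a bounded family at one representation. -/
def evalAt (Λ : PGraph P C) (i : SomeRep.{w} Λ) : BigProduct.{w} Λ →⋆ₙₐ[ℂ] i.carrier where
  toFun f := f i
  map_smul' _ _ := rfl
  map_zero' := rfl
  map_add' _ _ := rfl
  map_mul' _ _ := rfl
  map_star' _ := rfl

/-- The homomorphism `ρ_τ : B(Λ) → C*(τ)` given by the universal property. -/
def rho (Λ : PGraph P C) {B : Type w} [NonUnitalCStarAlgebra B] (τ : Λ.Representation B) :
    BalAlg.{w} Λ →⋆ₙₐ[ℂ] cstarGenerated (Set.range τ) :=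
  NonUnitalStarAlgHom.codRestrict
    ((evalAt Λ ⟨B, τ⟩).comp
      (NonUnitalStarSubalgebraClass.subtype (cstarGenerated (Set.range (genProduct.{w} Λ)))))
    (cstarGenerated (Set.range τ)) (by
      rintro ⟨f, hf⟩
      have hcont : Continuous (evalAt Λ ⟨B, τ⟩) :=
        (lp.evalCLM ℂ (fun i : SomeRep.{w} Λ => i.carrier) (p := ∞) ⟨B, τ⟩).continuous
      have hle : cstarGenerated (Set.range (genProduct.{w} Λ)) ≤
          NonUnitalStarSubalgebra.comap (evalAt Λ ⟨B, τ⟩) (cstarGenerated (Set.range τ)) := by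
        refine NonUnitalStarSubalgebra.topologicalClosure_minimal _
          (NonUnitalStarAlgebra.adjoin_le ?_)
          ((cstarGenerated.isClosed (Set.range τ)).preimage hcont)
        rintro _ ⟨x, rfl⟩
        exact subset_cstarGenerated (Set.range τ) ⟨x, rfl⟩
      exact hle hf)

theorem rho_omega (Λ : PGraph P C) [Λ.FinitelyAligned] {B : Type w} [NonUnitalCStarAlgebra B]
    (τ : Λ.Representation B) (x : Λ.Balanced) : (Λ.rho τ (Λ.omega x) : B) = τ x := rfl

end Universal

/-! ### Gap products and generated ideals -/

/-- The product of the members of a nonempty list in a ring without unit (with the value `0` for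
the empty list). -/
def _root_.listProd {A : Type*} [Zero A] [Mul A] : List A → A
  | [] => 0
  | [a] => a
  | a :: b :: l => a * listProd (b :: l)

theorem _root_.listProd_perm {A : Type*} [NonUnitalRing A] {l l' : List A} (h : l.Perm l')
    (hc : ∀ a ∈ l, ∀ b ∈ l, Commute a b) : listProd l = listProd l' := by
  have hcons : ∀ (a : A) (l : List A), l ≠ [] → listProd (a :: l) = a * listProd l := by
    rintro a (_ | ⟨b, l⟩) hl
    · exact absurd rfl hl
    · rfl
  induction h with
  | nil => rfl
  | @cons a l₁ l₂ h ih =>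
    by_cases h1 : l₁ = []
    · subst h1
      rw [List.nil_perm.1 h]
    · have h2 : l₂ ≠ [] := fun h2 => h1 (List.perm_nil.1 (h2 ▸ h))
      rw [hcons a l₁ h1, hcons a l₂ h2,
        ih fun x hx y hy => hc x (List.mem_cons_of_mem _ hx) y (List.mem_cons_of_mem _ hy)]
  | swap a b l =>
    have hab : Commute b a := hc b (by simp) a (by simp)
    rcases l with _ | ⟨c, l⟩
    · exact hab
    · change b * (a * _) = a * (b * _)
      rw [← mul_assoc, hab.eq, mul_assoc]
  | trans h1 _ ih1 ih2 =>
    exact (ih1 hc).trans (ih2 fun a ha b hb => hc a (h1.mem_iff.2 ha) b (h1.mem_iff.2 hb))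

namespace Representation

variable {Λ : PGraph P C} {B : Type w} [NonUnitalCStarAlgebra B]

/-- The difference `τ_{μ,μ} - τ_{μα,μα}`, for `α ∈ s(μ)Λ`. -/
def gap (τ : Λ.Representation B) (μ : Mor C) (α : MorTo μ.dom) : B :=
  τ (Balanced.diag Λ μ) - τ (Balanced.diag Λ (μ.comp α.1 α.2))

/-- The gap product `∏_{α ∈ E} (τ_{μ,μ} - τ_{μα,μα})`, for finite nonempty `E ⊆ s(μ)Λ`. -/
def gapProd (τ : Λ.Representation B) (μ : Mor C) (E : Finset (MorTo μ.dom)) : B :=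
  listProd (E.toList.map (τ.gap μ))

theorem gapProd_eq_of_perm (τ : Λ.Representation B) (μ : Mor C) (E : Finset (MorTo μ.dom))
    (l : List (MorTo μ.dom)) (hl : l.Perm E.toList) :
    τ.gapProd μ E = listProd (l.map (τ.gap μ)) := by
  refine listProd_perm (hl.symm.map _) ?_
  intro a ha b hb
  obtain ⟨α, -, rfl⟩ := List.mem_map.1 ha
  obtain ⟨β, -, rfl⟩ := List.mem_map.1 hb
  exact ((τ.commute_diag _ _).sub_left (τ.commute_diag _ _)).sub_right
    ((τ.commute_diag _ _).sub_left (τ.commute_diag _ _))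

end Representation

/-- The closed two-sided ideal generated by `S`: the smallest closed subspace that contains `S` and
absorbs multiplication from both sides. -/
def _root_.closedIdeal {A : Type*} [NonUnitalCStarAlgebra A] (S : Set A) : Submodule ℂ A :=
  sInf {I : Submodule ℂ A | IsClosed (I : Set A) ∧ S ⊆ I ∧
    ∀ a : A, ∀ x ∈ I, a * x ∈ I ∧ x * a ∈ I}

end PGraph

end

/-! ### The quasi-lattice order and its joins. -/

namespace LeftLE

variable {G : Type*} [Group G] {P : Submonoid G}

/-! The products of gap elements listed are sent to zero by `ρ_τ`, so the point is that nothing else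
is needed. Every finite set of paths lies in a finite set `F` closed under the extensions that occur
in products (`exists_finite_MCEClosed`), so the `ω_{μ,ν}` with `μ, ν ∈ F` span a finite-dimensional,
hence closed, star subalgebra. Truncation by functional calculus reduces the kernel to its
intersections with these subalgebras (`mem_of_map_eq_zero_of_dense`).

Inside one of them (`mem_of_mem_gradedSpan`), let `Q_μ` be the product of the gaps at `μ` over all
proper extensions of `μ` in `F`. Take `x` in the kernel and a degree `p` minimal among those allowed
in `x`. For `d(μ) = p`, multiplying by `Q_μ` on the left and `ω_{ν,μ}` on the right isolates one
coefficient: `Q_μ x ω_{ν,μ} = c Q_μ`. Hence `c = 0` or `Q_μ` is in the kernel. In the latter case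
the extension set is exhaustive, because every `τ_{λ,λ}` is nonzero, so `Q_μ` is one of the
generators. Modulo the ideal each term `c ω_{μ,ν}` may then be replaced by `c (ω_{μ,ν} - Q_μ
ω_{μ,ν})`, which involves only degrees strictly above `p`. Induction on the finite set of degrees
finishes the proof. -/

theorem refl (p : G) : LeftLE P p p := by simp [LeftLE]

theorem trans {p q r : G} (h : LeftLE P p q) (h' : LeftLE P q r) : LeftLE P p r := by
  simpa [LeftLE, mul_assoc] using P.mul_mem h h'

theorem antisymm [IsQuasiLatticeOrdered P] {p q : G} (h : LeftLE P p q) (h' : LeftLE P q p) :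
    p = q :=
  inv_mul_eq_one.1 (IsQuasiLatticeOrdered.eq_one_of_inv_mem _ h (by simpa [LeftLE] using h'))

theorem mul_right (p : G) {q : G} (hq : q ∈ P) : LeftLE P p (p * q) := by
  simpa [LeftLE] using hq

end LeftLE

namespace IsJoin

variable {G : Type*} [Group G] {P : Submonoid G}

theorem symm {p q r : G} (h : IsJoin P p q r) : IsJoin P q p r :=
  ⟨h.1, h.2.2.1, h.2.1, fun t ht a b => h.2.2.2 t ht b a⟩

theorem of_le {p q : G} (hq : q ∈ P) (h : LeftLE P p q) : IsJoin P p q q :=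
  ⟨hq, h, LeftLE.refl q, fun _ _ _ h => h⟩

/-- A finite set is contained in a finite set that is closed under joins. -/
theorem exists_finite_closed [IsQuasiLatticeOrdered P] {D : Set G} (hD : D.Finite)
    (hP : D ⊆ P) :
    ∃ D' : Set G, D'.Finite ∧ D ⊆ D' ∧ ∀ p ∈ D', ∀ q ∈ D', ∀ r, IsJoin P p q r → r ∈ D' := by
  -- The closed set consists of the least upper bounds of all subsets of `D`: there are finitely
  -- many subsets, each has at most one, and a join of two is the bound of the union.
  let lub (S : Set G) (r : G) : Prop :=
    r ∈ P ∧ (∀ s ∈ S, LeftLE P s r) ∧ ∀ t ∈ P, (∀ s ∈ S, LeftLE P s t) → LeftLE P r t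
  refine ⟨⋃ S ∈ {S | S ⊆ D}, {r | lub S r}, ?_, ?_, ?_⟩
  · refine hD.finite_subsets.biUnion fun S _ => Set.Subsingleton.finite ?_
    rintro r ⟨h1, h2, h3⟩ r' ⟨h1', h2', h3'⟩
    exact LeftLE.antisymm (h3 _ h1' h2') (h3' _ h1 h2)
  · intro p hp
    simp only [Set.mem_iUnion]
    refine ⟨{p}, by simpa using hp, hP hp, ?_, ?_⟩
    · rintro s rfl
      exact LeftLE.refl _
    · exact fun t _ h => h p rfl
  · intro p hp q hq r hr
    simp only [Set.mem_iUnion] at hp hq ⊢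
    obtain ⟨S, hS, _, hp1, hp2⟩ := hp
    obtain ⟨T, hT, _, hq1, hq2⟩ := hq
    refine ⟨S ∪ T, Set.union_subset hS hT, hr.1, ?_, ?_⟩
    · rintro s (hs | hs)
      · exact (hp1 s hs).trans hr.2.1
      · exact (hq1 s hs).trans hr.2.2.1
    · exact fun t ht h => hr.2.2.2 t ht (hp2 t ht fun s hs => h s (Or.inl hs))
        (hq2 t ht fun s hs => h s (Or.inr hs))

end IsJoin

/-! ### Composition and unique factorisation of paths. -/

namespace Mor

variable {C : Type u} [Category.{v} C]

theorem ident_comp (μ : Mor C) : (ident μ.cod).comp μ rfl = μ := by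
  simp [comp, ident]

theorem comp_congr_right {μ ν ν' : Mor C} (h : ν = ν') {hν : ν.cod = μ.dom} :
    μ.comp ν hν = μ.comp ν' (h ▸ hν) := by
  subst h
  rfl

theorem comp_assoc (μ ν ξ : Mor C) (h : ν.cod = μ.dom) (h' : ξ.cod = ν.dom) :
    (μ.comp ν h).comp ξ h' = μ.comp (ν.comp ξ h') h := by
  simp [comp]

end Mor

namespace PGraph

variable {G : Type*} [Group G] {P : Submonoid G} {C : Type u} [Category.{v} C]

theorem deg_ident (Λ : PGraph P C) (o : C) : Λ.deg (Mor.ident o) = 1 :=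
  Λ.degree.map_id _

theorem eq_ident_of_deg_eq_one (Λ : PGraph P C) {α : Mor C} (h : Λ.deg α = 1) :
    α = Mor.ident α.cod := by
  have e1 : (Mor.ident α.cod).comp α rfl = α.comp (Mor.ident α.dom) rfl := by
    rw [Mor.ident_comp, Mor.comp_ident]
  exact (Λ.comp_inj e1 (by rw [Λ.deg_ident, h])).1.symm

theorem comp_eq_self (Λ : PGraph P C) {μ α : Mor C} (h : α.cod = μ.dom)
    (hd : Λ.deg (μ.comp α h) = Λ.deg μ) : μ.comp α h = μ := by
  have h1 : Λ.deg α = 1 := by simpa [deg_comp] using hd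
  have h2 := Λ.eq_ident_of_deg_eq_one h1
  rw [h] at h2
  subst h2
  exact Mor.comp_ident μ

theorem le_deg_comp (Λ : PGraph P C) (μ α : Mor C) (h : α.cod = μ.dom) :
    LeftLE P (Λ.deg μ : G) (Λ.deg (μ.comp α h) : G) := by
  rw [deg_comp]
  exact LeftLE.mul_right _ (Λ.deg α).2

theorem deg_comp_congr (Λ : PGraph P C) {μ ν α : Mor C} (h : α.cod = μ.dom) (h' : α.cod = ν.dom)
    (hd : Λ.deg μ = Λ.deg ν) : Λ.deg (μ.comp α h) = Λ.deg (ν.comp α h') := by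
  rw [deg_comp, deg_comp, hd]

theorem exists_prefix (Λ : PGraph P C) (lam : Mor C) {p : G} (hp : p ∈ P)
    (h : LeftLE P p (Λ.deg lam : G)) :
    ∃ (κ ζ : Mor C) (hζ : ζ.cod = κ.dom), lam = κ.comp ζ hζ ∧ (Λ.deg κ : G) = p := by
  obtain ⟨x, ⟨hx, e, d, _⟩, _⟩ := Λ.factorisation lam ⟨p, hp⟩ ⟨_, h⟩
    (Subtype.ext (by simp [deg]))
  exact ⟨x.1, x.2, hx, e, congrArg Subtype.val d⟩

theorem prefix_of_le (Λ : PGraph P C) {μ ν κ ζ : Mor C} {h : ν.cod = μ.dom} {h' : ζ.cod = κ.dom}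
    (e : μ.comp ν h = κ.comp ζ h') (hd : LeftLE P (Λ.deg μ : G) (Λ.deg κ : G)) :
    ∃ (δ : Mor C) (hδ : δ.cod = μ.dom) (hζ : ζ.cod = δ.dom),
      κ = μ.comp δ hδ ∧ ν = δ.comp ζ hζ := by
  obtain ⟨κ', δ, hδ, rfl, d⟩ := Λ.exists_prefix κ (Λ.deg μ).2 hd
  obtain ⟨rfl, rfl⟩ := Λ.comp_inj (e.trans (Mor.comp_assoc κ' δ ζ hδ h')) (Subtype.ext d.symm)
  exact ⟨δ, hδ, h', rfl, rfl⟩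

/-! ### Minimal extensions and finite closed sets of paths. -/

namespace MinExt

variable {Λ : PGraph P C}

/-- The pair `(β, α)`. -/
def symm {ν ξ : Mor C} (e : Λ.MinExt ν ξ) : Λ.MinExt ξ ν where
  α := e.β
  β := e.α
  hα := e.hβ
  hβ := e.hα
  eq := e.eq.symm
  mem := ⟨e.eq ▸ e.mem.1.symm, _, _, e.hβ, e.hα, rfl, e.eq.symm⟩

/-- The pair `(α, β)` given by two factorisations of a path whose degree is a join. -/
def ofIsJoin {ν ξ α β : Mor C} (hα : α.cod = ν.dom) (hβ : β.cod = ξ.dom)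
    (eq : ν.comp α hα = ξ.comp β hβ)
    (h : IsJoin P (Λ.deg ν : G) (Λ.deg ξ : G) (Λ.deg (ν.comp α hα) : G)) : Λ.MinExt ν ξ where
  α := α
  β := β
  hα := hα
  hβ := hβ
  eq := eq
  mem := ⟨h, _, _, hα, hβ, rfl, eq⟩

end MinExt

/-- The set `F` of paths contains `μα` whenever it contains `μ`, `ν`, `ξ`, where `(μ, ν)` is
balanced and `να ∈ MCE(ν, ξ)`. -/
def MCEClosed (Λ : PGraph P C) (F : Set (Mor C)) : Prop :=
  ∀ μ ∈ F, ∀ ν ∈ F, ∀ ξ ∈ F, ∀ hs : μ.dom = ν.dom, Λ.deg μ = Λ.deg ν →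
    ∀ e : Λ.MinExt ν ξ, μ.comp e.α (e.hα.trans hs.symm) ∈ F

/-- The smallest set of paths that contains `E` and satisfies `MCEClosed`. -/
inductive MCEClosure (Λ : PGraph P C) (E : Set (Mor C)) : Mor C → Prop
  | base (lam : Mor C) : lam ∈ E → MCEClosure Λ E lam
  | step (μ ν ξ : Mor C) : MCEClosure Λ E μ → MCEClosure Λ E ν → MCEClosure Λ E ξ →
      ∀ hs : μ.dom = ν.dom, Λ.deg μ = Λ.deg ν → ∀ e : Λ.MinExt ν ξ,
        MCEClosure Λ E (μ.comp e.α (e.hα.trans hs.symm))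

namespace MCEClosure

variable {Λ : PGraph P C} {E : Set (Mor C)}

theorem deg_mem {D : Set G} (hE : ∀ lam ∈ E, (Λ.deg lam : G) ∈ D)
    (hD : ∀ p ∈ D, ∀ q ∈ D, ∀ r, IsJoin P p q r → r ∈ D) {lam : Mor C}
    (h : Λ.MCEClosure E lam) : (Λ.deg lam : G) ∈ D := by
  induction h with
  | base lam h => exact hE lam h
  | step μ ν ξ _ _ _ hs hd e _ ih2 ih3 =>
    rw [Λ.deg_comp_congr _ e.hα hd]
    exact hD _ ih2 _ ih3 _ e.mem.1

/-- The paths `λζ` with `λ ∈ L` and `λ'ζ ∈ B`, where `d(λ') = d(λ)`. -/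
def replacements (Λ : PGraph P C) (L B : Set (Mor C)) : Set (Mor C) :=
  {x | ∃ lam ∈ L, ∃ b ∈ B, ∃ (lam' ζ : Mor C) (h : ζ.cod = lam.dom) (h' : ζ.cod = lam'.dom),
    Λ.deg lam' = Λ.deg lam ∧ b = lam'.comp ζ h' ∧ x = lam.comp ζ h}

/-- Given `λ` and `b`, the segment `λ'` must be the prefix of `b` of degree `d(λ)`, so `ζ`, and with
it `λζ`, is determined. -/
theorem finite_replacements {L B : Set (Mor C)} (hL : L.Finite) (hB : B.Finite) :
    (replacements Λ L B).Finite := by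
  refine (hL.biUnion fun lam _ => hB.biUnion (t := fun b => {x | ∃ (lam' ζ : Mor C)
    (h : ζ.cod = lam.dom) (h' : ζ.cod = lam'.dom),
    Λ.deg lam' = Λ.deg lam ∧ b = lam'.comp ζ h' ∧ x = lam.comp ζ h}) fun b _ =>
      Set.Subsingleton.finite ?_).subset ?_
  · rintro _ ⟨l1, ζ, h, h', hd, rfl, rfl⟩ _ ⟨l2, ζ', g, g', gd, e, rfl⟩
    obtain ⟨-, rfl⟩ := Λ.comp_inj e (hd.trans gd.symm)
    rfl
  · rintro x ⟨lam, hl, b, hb, h⟩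
    simp only [Set.mem_iUnion]
    exact ⟨lam, hl, b, hb, h⟩

/-- Bounds degree `p` of the closure by lower degrees. A single replacement of an initial segment
suffices, since two successive replacements merge into one at the join of the degrees of the
replaced segments. -/
theorem mem_of_deg_eq [IsQuasiLatticeOrdered P] {p : G} {L B : Set (Mor C)}
    (hL : ∀ lam, lam ∈ L ↔
      Λ.MCEClosure E lam ∧ LeftLE P (Λ.deg lam : G) p ∧ (Λ.deg lam : G) ≠ p)
    (hB : ∀ lam, lam ∈ B ↔ lam ∈ E ∨ ∃ ν ∈ L, ∃ ξ ∈ L, lam ∈ Λ.MCE ν ξ)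
    {lam : Mor C} (h : Λ.MCEClosure E lam) (hp : (Λ.deg lam : G) = p) :
    lam ∈ B ∪ replacements Λ L B := by
  induction h with
  | base lam h => exact Or.inl ((hB lam).2 (Or.inl h))
  | step μ ν ξ hμ hν hξ hs hd e ih1 _ ih3 =>
    have hpν : (Λ.deg (ν.comp e.α e.hα) : G) = p := by
      rw [← hp, Λ.deg_comp_congr _ e.hα hd]
    have hνp : LeftLE P (Λ.deg ν : G) p := hpν ▸ Λ.le_deg_comp ν e.α e.hα
    -- If `μ` already has degree `p`, the extension is trivial; otherwise `μ` and `ν` have strictly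
    -- smaller degree.
    by_cases h1 : (Λ.deg μ : G) = p
    · rw [Λ.comp_eq_self (μ := μ) (α := e.α) _ (Subtype.ext (hp.trans h1.symm))]
      exact ih1 h1
    have hνL : ν ∈ L := (hL ν).2 ⟨hν, hνp, hd ▸ h1⟩
    have hμL : μ ∈ L := (hL μ).2 ⟨hμ, hd ▸ hνp, h1⟩
    have key : ν.comp e.α e.hα ∈ B →
        μ.comp e.α (e.hα.trans hs.symm) ∈ B ∪ replacements Λ L B := fun hb =>
      Or.inr ⟨μ, hμL, _, hb, ν, e.α, _, e.hα, hd.symm, rfl, rfl⟩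
    have hpξ : (Λ.deg (ξ.comp e.β e.hβ) : G) = p := by rw [← e.eq, hpν]
    by_cases h2 : (Λ.deg ξ : G) = p
    · have h3 : ξ.comp e.β e.hβ = ξ := Λ.comp_eq_self _ (Subtype.ext (hpξ.trans h2.symm))
      rcases ih3 h2 with hb | ⟨lam, hlam, b, hb, lam', ζ, g, g', hd', rfl, rfl⟩
      · exact key (by rwa [e.eq, h3])
      -- Here `ξ = να` is itself a replacement `λζ`. Cut it at `t = d(ν) ∨ d(λ)`: if `t = p`, then
      -- `να` is a minimal common extension of two paths in `L`; otherwise `μα` agrees with the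
      -- element of `B` beyond degree `t`, and its prefix of degree `t` is again in `L`.
      have hlam' := (hL lam).1 hlam
      have heq : ν.comp e.α e.hα = lam.comp ζ g := e.eq.trans h3
      obtain ⟨t, ht⟩ := IsQuasiLatticeOrdered.exists_join (P := P) (Λ.deg ν : G) (Λ.deg lam : G)
        ⟨p, hp ▸ (Λ.deg _).2, hνp, hlam'.2.1⟩
      have htp : LeftLE P t p := ht.2.2.2 p (hp ▸ (Λ.deg _).2) hνp hlam'.2.1
      by_cases h4 : t = p
      · exact key ((hB _).2 (Or.inr ⟨ν, hνL, lam, hlam, by rwa [hpν, ← h4], _, _, e.hα, g, rfl,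
          heq⟩))
      obtain ⟨κ, ζ', hζ', hκ, hκd⟩ := Λ.exists_prefix (ν.comp e.α e.hα) ht.1 (hpν ▸ htp)
      obtain ⟨δ', hδ', hc', e1, e2⟩ := Λ.prefix_of_le hκ (hκd ▸ ht.2.1)
      obtain ⟨δ, hδ, hc, e3, e4⟩ := Λ.prefix_of_le (heq.symm.trans hκ) (hκd ▸ ht.2.2.1)
      let f : Λ.MinExt ν lam := MinExt.ofIsJoin hδ' hδ (e1.symm.trans e3)
        (by rw [← e1, hκd]; exact ht)
      have hfd : (Λ.deg (μ.comp δ' (hδ'.trans hs.symm)) : G) = t := by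
        rw [Λ.deg_comp_congr _ hδ' hd, ← e1, hκd]
      refine Or.inr ⟨μ.comp δ' (hδ'.trans hs.symm),
        (hL _).2 ⟨step μ ν lam hμ hν hlam'.1 hs hd f, ?_, ?_⟩, _, hb,
        lam'.comp δ (by rw [← g', e4]; rfl), ζ', hc', hc, ?_, ?_, ?_⟩
      · rwa [hfd]
      · rwa [hfd]
      · rw [Λ.deg_comp_congr _ hδ hd', Λ.deg_comp_congr _ hδ' hd, ← e1, ← e3]
      · subst e4
        rw [Mor.comp_assoc]
      · exact (Mor.comp_congr_right e2).trans (Mor.comp_assoc ..).symm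
    · have hξL : ξ ∈ L := (hL ξ).2 ⟨hξ, hpξ ▸ Λ.le_deg_comp ξ e.β e.hβ, h2⟩
      exact key ((hB _).2 (Or.inr ⟨ν, hνL, ξ, hξL, e.mem⟩))

end MCEClosure

/-- In a finitely aligned graph, finite sets of paths lie in finite closed ones. -/
theorem exists_finite_MCEClosed [IsQuasiLatticeOrdered P] (Λ : PGraph P C) [Λ.FinitelyAligned]
    {E : Set (Mor C)} (hE : E.Finite) : ∃ F : Set (Mor C), F.Finite ∧ E ⊆ F ∧ Λ.MCEClosed F := by
  refine ⟨{lam | Λ.MCEClosure E lam}, ?_, fun lam h => .base lam h,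
    fun μ hμ ν hν ξ hξ hs hd e => MCEClosure.step μ ν ξ hμ hν hξ hs hd e⟩
  obtain ⟨D, hDfin, hED, hD⟩ := IsJoin.exists_finite_closed (P := P)
    (hE.image fun lam => (Λ.deg lam : G)) (by rintro _ ⟨lam, _, rfl⟩; exact (Λ.deg lam).2)
  have hdeg : ∀ lam, Λ.MCEClosure E lam → (Λ.deg lam : G) ∈ D := fun lam h =>
    h.deg_mem (fun x hx => hED ⟨x, hx, rfl⟩) hD
  have := hDfin.to_subtype
  let r (p q : D) : Prop := LeftLE P (p : G) q ∧ p ≠ q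
  have hr : IsTrans D r := ⟨fun a b c h h' => ⟨h.1.trans h'.1, fun hac => by
    subst hac
    exact h.2 (Subtype.ext (h.1.antisymm h'.1))⟩⟩
  have hi : Std.Irrefl r := ⟨fun a h => h.2 rfl⟩
  -- Well-founded induction over the finite set `D` of degrees available to the closure.
  have key : ∀ p : D, {lam | Λ.MCEClosure E lam ∧ (Λ.deg lam : G) = p}.Finite := by
    intro p
    induction p using (Finite.wellFounded_of_trans_of_irrefl r).induction with
    | _ p ih =>
    have hL : {lam | Λ.MCEClosure E lam ∧ LeftLE P (Λ.deg lam : G) p ∧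
        (Λ.deg lam : G) ≠ p}.Finite := by
      refine ((Set.toFinite {q : D | r q p}).biUnion fun q hq => ih q hq).subset ?_
      rintro lam ⟨h1, h2, h3⟩
      simp only [Set.mem_iUnion]
      exact ⟨⟨_, hdeg lam h1⟩, ⟨h2, fun h => h3 (congrArg Subtype.val h)⟩, h1, rfl⟩
    have hB := hE.union (hL.biUnion fun ν _ => hL.biUnion fun ξ _ =>
      FinitelyAligned.finite_MCE (Λ := Λ) ν ξ)
    refine (hB.union (MCEClosure.finite_replacements (Λ := Λ) hL hB)).subset ?_
    rintro lam ⟨h1, h2⟩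
    refine MCEClosure.mem_of_deg_eq (fun _ => Iff.rfl) (fun lam => ?_) h1 h2
    simp only [Set.mem_union, Set.mem_iUnion, exists_prop]
    rfl
  refine (Set.finite_iUnion key).subset fun lam h => ?_
  exact Set.mem_iUnion.2 ⟨⟨_, hdeg lam h⟩, h, rfl⟩

end PGraph

/-! ### Kernels and dense families of closed subalgebras. -/

/-- Truncation of a selfadjoint element: an element `a` whose image is small in norm is close to
an element of the kernel in the closed subalgebra generated by `a`. -/
theorem exists_mem_ker_norm_sub_le {A D : Type*} [NonUnitalCStarAlgebra A]
    [NonUnitalCStarAlgebra D] (φ : A →⋆ₙₐ[ℂ] D) {S : NonUnitalStarSubalgebra ℂ A}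
    (hS : IsClosed (S : Set A)) {a : A} (haS : a ∈ S) (ha : IsSelfAdjoint a) {ε : ℝ}
    (hε : 0 ≤ ε) (hφ : ‖φ a‖ ≤ ε) : ∃ b ∈ S, φ b = 0 ∧ ‖a - b‖ ≤ ε := by
  -- The witness is `a - g(a)`. The spectrum of `φ a` lies in `[-ε, ε]`, where `g` is the identity,
  -- so `φ` kills it, while `‖g(a)‖ ≤ ε`.
  let g : ℝ → ℝ := fun t => max (-ε) (min ε t)
  have hg : Continuous g := by fun_prop
  have hg0 : g 0 = 0 := by simp [g, hε]
  have hmem : cfcₙ g a ∈ S := cfcₙ_mem (hs := hS) g haS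
  refine ⟨a - cfcₙ g a, S.sub_mem haS hmem, ?_, ?_⟩
  · have hφa : IsSelfAdjoint (φ a) := ha.map φ
    have hφc : Continuous φ := AddMonoidHomClass.continuous_of_bound φ 1 fun y => by
      simpa using NonUnitalStarAlgHom.norm_apply_le φ y
    rw [map_sub, NonUnitalStarAlgHomClass.map_cfcₙ φ g a hg.continuousOn hg0 hφc ha hφa]
    have : cfcₙ g (φ a) = cfcₙ (fun t : ℝ => t) (φ a) := by
      refine cfcₙ_congr fun t ht => ?_
      have h2 : ‖t‖ ≤ ε := by
        have := norm_apply_le_norm_cfcₙ (fun t : ℝ => t) (φ a) ht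
        rw [cfcₙ_id' ℝ (φ a)] at this
        exact this.trans hφ
      have := abs_le.1 h2
      simp [g, this.1, this.2]
    rw [this, cfcₙ_id' ℝ (φ a), sub_self]
  · rw [sub_sub_cancel]
    refine norm_cfcₙ_le fun t _ => ?_
    rw [Real.norm_eq_abs, abs_le]
    exact ⟨le_max_left _ _, max_le (by linarith) (min_le_left _ _)⟩

/-- Kernels of homomorphisms are determined by a family of closed subalgebras with dense union. -/
theorem mem_of_map_eq_zero_of_dense {A D : Type*} [NonUnitalCStarAlgebra A]
    [NonUnitalCStarAlgebra D] (φ : A →⋆ₙₐ[ℂ] D) (J : Submodule ℂ A) (hJ : IsClosed (J : Set A))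
    (h : ∀ x : A, ∀ ε > 0, ∃ S : NonUnitalStarSubalgebra ℂ A, IsClosed (S : Set A) ∧
      (∀ y ∈ S, φ y = 0 → y ∈ J) ∧ ∃ a ∈ S, ‖x - a‖ < ε) {x : A} (hx : φ x = 0) : x ∈ J := by
  have key : ∀ x : A, IsSelfAdjoint x → φ x = 0 → x ∈ J := by
    intro x hsa hx
    rw [← SetLike.mem_coe, ← hJ.closure_eq, Metric.mem_closure_iff]
    intro ε hε
    obtain ⟨S, hSc, hSJ, c, hcS, hc⟩ := h x (ε / 2) (by positivity)
    let a : A := (realPart c : A)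
    have haS : a ∈ S := by
      simp only [a, realPart_apply_coe]
      rw [← Complex.coe_smul]
      exact SMulMemClass.smul_mem _ (add_mem hcS (star_mem (s := S) hcS))
    have hxa : ‖x - a‖ < ε / 2 := by
      have : x - a = (realPart (x - c) : A) := by
        simp [a, hsa.coe_realPart]
      rw [this]
      exact (realPart.norm_le _).trans_lt hc
    have hφa : ‖φ a‖ ≤ ε / 2 := by
      have : φ a = - φ (x - a) := by simp [hx]
      rw [this, norm_neg]
      exact (NonUnitalStarAlgHom.norm_apply_le φ _).trans hxa.le
    obtain ⟨b, hbS, hb0, hb⟩ := exists_mem_ker_norm_sub_le φ hSc haS (realPart c).2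
      (by positivity) hφa
    refine ⟨b, hSJ b hbS hb0, ?_⟩
    rw [dist_eq_norm]
    calc ‖x - b‖ = ‖(x - a) + (a - b)‖ := by simp
      _ ≤ ‖x - a‖ + ‖a - b‖ := norm_add_le _ _
      _ < ε := by linarith
  rw [← realPart_add_I_smul_imaginaryPart x]
  refine J.add_mem (key _ (realPart x).2 ?_) (J.smul_mem _ (key _ (imaginaryPart x).2 ?_))
  · rw [realPart_apply_coe, ← Complex.coe_smul, map_smul, map_add, map_star, hx]
    simp
  · rw [imaginaryPart_apply_coe, ← Complex.coe_smul, map_smul, map_smul, map_sub, map_star, hx]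
    simp

/-- Nonempty finite sets have minimal elements for the left-invariant order. -/
theorem LeftLE.exists_minimal {G : Type*} [Group G] {P : Submonoid G} [IsQuasiLatticeOrdered P]
    {U : Finset G} (hU : U.Nonempty) : ∃ p ∈ U, ∀ q ∈ U, LeftLE P q p → q = p := by
  let : PartialOrder G :=
    { le := LeftLE P
      le_refl := LeftLE.refl
      le_trans := fun _ _ _ => LeftLE.trans
      le_antisymm := fun _ _ => LeftLE.antisymm }
  obtain ⟨p, hp⟩ := U.exists_minimal hU
  exact ⟨p, hp.1, fun q hq h => LeftLE.antisymm h (hp.2 hq h)⟩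

theorem IsJoin.of_mul_left {G : Type*} [Group G] {P : Submonoid G} {m p q r : G} (hm : m ∈ P)
    (hp : p ∈ P) (h : IsJoin P (m * p) (m * q) (m * r)) : IsJoin P p q r := by
  have hc : ∀ a b : G, LeftLE P (m * a) (m * b) ↔ LeftLE P a b := fun a b => by
    simp [LeftLE, mul_assoc]
  have hpr := (hc p r).1 h.2.1
  refine ⟨?_, hpr, (hc q r).1 h.2.2.1, fun t ht h1 h2 =>
    (hc r t).1 (h.2.2.2 _ (P.mul_mem hm ht) ((hc p t).2 h1) ((hc q t).2 h2))⟩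
  simpa using P.mul_mem hp hpr

theorem Submodule.mul_mem_of_mem_span {A : Type*} [NonUnitalRing A] [Module ℂ A]
    [IsScalarTower ℂ A A] [SMulCommClass ℂ A A] {S T : Set A} {W : Submodule ℂ A}
    (h : ∀ a ∈ S, ∀ b ∈ T, a * b ∈ W) {x y : A} (hx : x ∈ span ℂ S) (hy : y ∈ span ℂ T) :
    x * y ∈ W := by
  induction hx using span_induction with
  | zero => simp
  | add a b _ _ ha hb => rw [add_mul]; exact W.add_mem ha hb
  | smul c a _ ha => rw [smul_mul_assoc]; exact W.smul_mem c ha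
  | mem a ha =>
    induction hy using span_induction with
    | zero => simp
    | add b c _ _ hb hc => rw [mul_add]; exact W.add_mem hb hc
    | smul c b _ hb => rw [mul_smul_comm]; exact W.smul_mem c hb
    | mem b hb => exact h a ha b hb

/-! ### Spans graded by degree, and relations among the `σ_{μ,ν}`. -/

namespace PGraph

variable {G : Type*} [Group G] {P : Submonoid G} {C : Type u} [Category.{v} C]

namespace Representation

variable {Λ : PGraph P C} {A : Type*} [NonUnitalCStarAlgebra A] (σ : Λ.Representation A)

/-- The span of the `σ_{μ,ν}` with `μ, ν ∈ F` and `d(μ) ∈ U`. -/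
def gradedSpan (F : Set (Mor C)) (U : Set G) : Submodule ℂ A :=
  Submodule.span ℂ (σ '' {z | z.fst ∈ F ∧ z.snd ∈ F ∧ (Λ.deg z.fst : G) ∈ U})

variable {σ}

theorem mem_gradedSpan {F : Set (Mor C)} {U : Set G} {z : Λ.Balanced} (h1 : z.fst ∈ F)
    (h2 : z.snd ∈ F) (h3 : (Λ.deg z.fst : G) ∈ U) : σ z ∈ σ.gradedSpan F U :=
  Submodule.subset_span ⟨z, ⟨h1, h2, h3⟩, rfl⟩

theorem gradedSpan_mono {F : Set (Mor C)} {U V : Set G}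
    (h : ∀ lam ∈ F, (Λ.deg lam : G) ∈ U → (Λ.deg lam : G) ∈ V) :
    σ.gradedSpan F U ≤ σ.gradedSpan F V :=
  Submodule.span_mono (Set.image_mono fun _ hz => ⟨hz.1, hz.2.1, h _ hz.1 hz.2.2⟩)

theorem apply_mul_apply_mem [Λ.FinitelyAligned] (W : Submodule ℂ A) {y z : Λ.Balanced}
    (h : ∀ e : Λ.MinExt y.snd z.fst, σ (y.extend z e) ∈ W) : σ y * σ z ∈ W := by
  have := Fintype.ofFinite (Λ.MinExt y.snd z.fst)
  rw [σ.mul_eq, finsum_eq_sum_of_fintype]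
  exact W.sum_mem fun e _ => h e

theorem _root_.PGraph.MCEClosed.extend_mem {F : Set (Mor C)} (hF : Λ.MCEClosed F)
    {y z : Λ.Balanced} (hy : y.fst ∈ F ∧ y.snd ∈ F) (hz : z.fst ∈ F ∧ z.snd ∈ F)
    (e : Λ.MinExt y.snd z.fst) : (y.extend z e).fst ∈ F ∧ (y.extend z e).snd ∈ F :=
  ⟨hF _ hy.1 _ hy.2 _ hz.1 y.source_eq y.deg_eq e,
    hF _ hz.2 _ hz.1 _ hy.2 z.source_eq.symm z.deg_eq.symm e.symm⟩

/-- Multiplication on the right only lengthens the first path, so an upward closed set of degrees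
gives a right ideal. -/
theorem gradedSpan_mul_mem_left [Λ.FinitelyAligned] {F : Set (Mor C)} (hF : Λ.MCEClosed F)
    {U : Set G}
    (hU : ∀ p ∈ U, ∀ lam ∈ F, LeftLE P p (Λ.deg lam : G) → (Λ.deg lam : G) ∈ U) {x y : A}
    (hx : x ∈ σ.gradedSpan F U) (hy : y ∈ σ.gradedSpan F Set.univ) :
    x * y ∈ σ.gradedSpan F U := by
  refine Submodule.mul_mem_of_mem_span ?_ hx hy
  rintro _ ⟨a, ha, rfl⟩ _ ⟨b, hb, rfl⟩
  refine apply_mul_apply_mem _ fun e => ?_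
  have h := hF.extend_mem ⟨ha.1, ha.2.1⟩ ⟨hb.1, hb.2.1⟩ e
  exact mem_gradedSpan h.1 h.2 (hU _ ha.2.2 _ h.1 (Λ.le_deg_comp _ _ _))

theorem star_mem_gradedSpan {F : Set (Mor C)} {U : Set G} {x : A} (hx : x ∈ σ.gradedSpan F U) :
    star x ∈ σ.gradedSpan F U := by
  induction hx using Submodule.span_induction with
  | zero => simp
  | add a b _ _ ha hb => rw [star_add]; exact Submodule.add_mem _ ha hb
  | smul c a _ ha => rw [star_smul]; exact Submodule.smul_mem _ _ ha
  | mem a ha =>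
    obtain ⟨z, hz, rfl⟩ := ha
    rw [σ.star_eq]
    exact mem_gradedSpan hz.2.1 hz.1 (z.deg_eq ▸ hz.2.2 : (Λ.deg z.snd : G) ∈ U)

variable (σ) in
/-- The star subalgebra spanned by the `σ_{μ,ν}` with `μ, ν ∈ F`. -/
def gradedSubalgebra [Λ.FinitelyAligned] {F : Set (Mor C)} (hF : Λ.MCEClosed F) :
    NonUnitalStarSubalgebra ℂ A where
  carrier := σ.gradedSpan F Set.univ
  add_mem' := Submodule.add_mem _
  zero_mem' := Submodule.zero_mem _
  smul_mem' := fun c _ => Submodule.smul_mem _ c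
  mul_mem' := gradedSpan_mul_mem_left hF fun _ _ _ _ _ => Set.mem_univ _
  star_mem' := star_mem_gradedSpan

theorem finite_balanced {F : Set (Mor C)} (hF : F.Finite) :
    {z : Λ.Balanced | z.fst ∈ F ∧ z.snd ∈ F}.Finite := by
  refine ((hF.prod hF).preimage (f := fun z : Λ.Balanced => (z.fst, z.snd)) ?_).subset ?_
  · intro z _ z' _ h
    exact Balanced.ext (congrArg Prod.fst h) (congrArg Prod.snd h)
  · exact fun z hz => hz

theorem isClosed_gradedSubalgebra [Λ.FinitelyAligned] {F : Set (Mor C)} (hF : Λ.MCEClosed F)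
    (hfin : F.Finite) : IsClosed (σ.gradedSubalgebra hF : Set A) := by
  have : FiniteDimensional ℂ (σ.gradedSpan F Set.univ) :=
    FiniteDimensional.span_of_finite ℂ (((finite_balanced hfin).subset
      fun z hz => ⟨hz.1, hz.2.1⟩).image σ)
  exact (σ.gradedSpan F Set.univ).closed_of_finiteDimensional

theorem diag_mul_diag_self [IsQuasiLatticeOrdered P] (μ : Mor C) :
    σ (Balanced.diag Λ μ) * σ (Balanced.diag Λ μ) = σ (Balanced.diag Λ μ) :=
  σ.swap_mul_self (Balanced.diag Λ μ)

/-- With `q = σ_{ν,ν}` and `σ_z* σ_z = q`, the expansion of `(σ_z q - σ_z)* (σ_z q - σ_z)` cancels,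
and the `C*`-identity applies. -/
theorem mul_diag [IsQuasiLatticeOrdered P] (z : Λ.Balanced) :
    σ z * σ (Balanced.diag Λ z.snd) = σ z := by
  have h1 := σ.swap_mul_self z
  have h2 := σ.diag_mul_diag_self z.snd
  have h3 := σ.star_eq (Balanced.diag Λ z.snd)
  rw [← sub_eq_zero, ← CStarRing.star_mul_self_eq_zero_iff]
  change star _ = σ (Balanced.diag Λ z.snd) at h3
  rw [star_sub, star_mul, h3, σ.star_eq, mul_sub, sub_mul, sub_mul, mul_assoc, ← mul_assoc _ (σ z),
    h1, mul_assoc _ _ (σ z), h1, h2]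
  simp [h2]

theorem diag_mul [IsQuasiLatticeOrdered P] (z : Λ.Balanced) :
    σ (Balanced.diag Λ z.fst) * σ z = σ z := by
  have h := congrArg star (σ.mul_diag z.swap)
  rw [star_mul, σ.star_eq, σ.star_eq] at h
  exact h

theorem mul_swap_self [IsQuasiLatticeOrdered P] (z : Λ.Balanced) :
    σ z * σ z.swap = σ (Balanced.diag Λ z.fst) :=
  σ.swap_mul_self z.swap

theorem diag_comp_mul_diag [IsQuasiLatticeOrdered P] (μ α : Mor C) (h : α.cod = μ.dom) :
    σ (Balanced.diag Λ (μ.comp α h)) * σ (Balanced.diag Λ μ) =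
      σ (Balanced.diag Λ (μ.comp α h)) := by
  have hle := Λ.le_deg_comp μ α h
  have hj := (IsJoin.of_le (P := P) (Λ.deg (μ.comp α h)).2 hle).symm
  have key : ∀ e : Λ.MinExt (μ.comp α h) μ, (μ.comp α h).comp e.α e.hα = μ.comp α h := fun e =>
    Λ.comp_eq_self _ (Subtype.ext ((e.mem.1.2.2.2 _ (Λ.deg _).2 (LeftLE.refl _) hle).antisymm
      e.mem.1.2.1))
  have hid := Mor.comp_ident (μ.comp α h)
  let e₀ : Λ.MinExt (μ.comp α h) μ := MinExt.ofIsJoin rfl h hid (by rwa [hid])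
  have huniq : ∀ e : Λ.MinExt (μ.comp α h) μ, e = e₀ := fun e =>
    MinExt.ext (Λ.comp_inj ((key e).trans (key e₀).symm) rfl).2
      (Λ.comp_inj ((e.eq.symm.trans (key e)).trans ((key e₀).symm.trans e₀.eq)) rfl).2
  rw [σ.mul_eq]
  have h0 := finsum_eq_single (fun e : Λ.MinExt (Balanced.diag Λ (μ.comp α h)).snd
    (Balanced.diag Λ μ).fst => σ ((Balanced.diag Λ (μ.comp α h)).extend (Balanced.diag Λ μ) e)) e₀
    (fun e he => absurd (huniq e) he)
  rw [h0]
  exact congrArg σ (Balanced.ext (key e₀) (e₀.eq.symm.trans (key e₀)))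

theorem mul_eq_zero_of_isEmpty {y z : Λ.Balanced} [IsEmpty (Λ.MinExt y.snd z.fst)] :
    σ y * σ z = 0 := by
  rw [σ.mul_eq, finsum_of_isEmpty]

/-- Distinct paths of equal degree have no common extension, by unique factorisation; this gives
matrix-unit relations within each degree. -/
theorem mul_eq_zero_of_deg_eq [IsQuasiLatticeOrdered P] {y z : Λ.Balanced}
    (hd : Λ.deg y.snd = Λ.deg z.fst) (hne : y.snd ≠ z.fst) : σ y * σ z = 0 := by
  have : IsEmpty (Λ.MinExt y.snd z.fst) := ⟨fun e => hne (Λ.comp_inj e.eq hd).1⟩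
  exact mul_eq_zero_of_isEmpty

theorem _root_.PGraph.Exhaustive.nonempty {o : C} {E : Set (MorTo o)} (hE : Λ.Exhaustive E) : E.Nonempty := by
  obtain ⟨α, hα, -⟩ := hE ⟨Mor.ident o, rfl⟩
  exact ⟨α, hα⟩

/-! ### Gap products -/

variable (σ) in
/-- The product of `∏ (σ_{μ,μ} - σ_{μα,μα})`, over the members `α` of a list, and `σ_{μ,μ}`. -/
def cutDown (μ : Mor C) : List (MorTo μ.dom) → A
  | [] => σ (Balanced.diag Λ μ)
  | α :: l => σ.gap μ α * cutDown μ l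

theorem commute_gap_diag (μ : Mor C) (α : MorTo μ.dom) (ν : Mor C) :
    Commute (σ.gap μ α) (σ (Balanced.diag Λ ν)) :=
  (σ.commute_diag _ _).sub_left (σ.commute_diag _ _)

theorem commute_cutDown_diag (μ : Mor C) (l : List (MorTo μ.dom)) (ν : Mor C) :
    Commute (σ.cutDown μ l) (σ (Balanced.diag Λ ν)) := by
  induction l with
  | nil => exact σ.commute_diag _ _
  | cons α l ih => exact (commute_gap_diag μ α ν).mul_left ih

/-- Left invariance of the order lets `μ` be cancelled from a minimal common extension of `μα` and
`μβ`. -/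
theorem diag_comp_mul_diag_comp_of_MCE_eq_empty {μ : Mor C} {α β : MorTo μ.dom}
    (h : Λ.MCE β.1 α.1 = ∅) : σ (Balanced.diag Λ (μ.comp α.1 α.2)) *
      σ (Balanced.diag Λ (μ.comp β.1 β.2)) = 0 := by
  refine @mul_eq_zero_of_isEmpty _ _ _ _ _ _ _ _ σ _ _ ⟨fun e => ?_⟩
  have heq : (μ.comp α.1 α.2).comp e.α e.hα = (μ.comp β.1 β.2).comp e.β e.hβ := e.eq
  have hj : IsJoin P (Λ.deg (μ.comp α.1 α.2) : G) (Λ.deg (μ.comp β.1 β.2) : G)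
    (Λ.deg ((μ.comp α.1 α.2).comp e.α e.hα) : G) := e.mem.1
  have heq' := (Mor.comp_assoc μ α.1 e.α α.2 e.hα).symm.trans
    (heq.trans (Mor.comp_assoc μ β.1 e.β β.2 e.hβ))
  have hd : Λ.deg ((μ.comp α.1 α.2).comp e.α e.hα) = Λ.deg μ * Λ.deg (α.1.comp e.α e.hα) :=
    (congrArg Λ.deg (Mor.comp_assoc μ α.1 e.α α.2 e.hα)).trans (Λ.deg_comp _ _ _)
  rw [hd, deg_comp, deg_comp] at hj
  have hj' := IsJoin.of_mul_left (Λ.deg μ).2 (Λ.deg α.1).2 hj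
  have : α.1.comp e.α e.hα ∈ Λ.MCE β.1 α.1 :=
    ⟨hj'.symm, e.β, e.α, e.hβ, e.hα, (Λ.comp_inj heq' rfl).2, rfl⟩
  rw [h] at this
  exact this

variable (Λ) in
/-- The paths `α ≠ s(μ)` with `μα ∈ F`. -/
noncomputable def properExt {F : Set (Mor C)} (hfin : F.Finite) (μ : Mor C) : Finset (MorTo μ.dom) :=
  Set.Finite.toFinset (s := {α : MorTo μ.dom | μ.comp α.1 α.2 ∈ F ∧ Λ.deg α.1 ≠ 1}) <| by
    refine (hfin.preimage (f := fun α : MorTo μ.dom => μ.comp α.1 α.2) ?_).subset fun _ h => h.1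
    exact fun α _ β _ h => Subtype.ext (Λ.comp_inj h rfl).2

theorem mem_properExt {F : Set (Mor C)} {hfin : F.Finite} {μ : Mor C} {α : MorTo μ.dom} :
    α ∈ properExt Λ hfin μ ↔ μ.comp α.1 α.2 ∈ F ∧ Λ.deg α.1 ≠ 1 :=
  Set.Finite.mem_toFinset _

section

variable [IsQuasiLatticeOrdered P]

theorem gap_mul_diag (μ : Mor C) (α : MorTo μ.dom) :
    σ.gap μ α * σ (Balanced.diag Λ μ) = σ.gap μ α := by
  rw [gap, sub_mul, diag_mul_diag_self, diag_comp_mul_diag]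

theorem listProd_map_gap {μ : Mor C} {l : List (MorTo μ.dom)} (hl : l ≠ []) :
    listProd (l.map (σ.gap μ)) = σ.cutDown μ l := by
  induction l with
  | nil => exact absurd rfl hl
  | cons α l ih =>
    cases l with
    | nil => exact (gap_mul_diag μ α).symm
    | cons β l => exact congrArg (σ.gap μ α * ·) (ih (by simp))

theorem gapProd_eq_cutDown {μ : Mor C} {E : Finset (MorTo μ.dom)} (hE : E.Nonempty) :
    σ.gapProd μ E = σ.cutDown μ E.toList :=
  listProd_map_gap (by simpa using hE.ne_empty)

theorem cutDown_mul_diag (μ : Mor C) (l : List (MorTo μ.dom)) :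
    σ.cutDown μ l * σ (Balanced.diag Λ μ) = σ.cutDown μ l := by
  induction l with
  | nil => exact diag_mul_diag_self μ
  | cons α l ih => rw [cutDown, mul_assoc, ih]

theorem cutDown_mul_diag_comp {μ : Mor C} {l : List (MorTo μ.dom)} {α : MorTo μ.dom}
    (hα : α ∈ l) : σ.cutDown μ l * σ (Balanced.diag Λ (μ.comp α.1 α.2)) = 0 := by
  induction l with
  | nil => simp at hα
  | cons β l ih =>
    rw [cutDown, mul_assoc]
    rcases List.mem_cons.1 hα with rfl | h
    · rw [(commute_cutDown_diag μ l _).eq, ← mul_assoc, gap, sub_mul, diag_mul_diag_self,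
        (σ.commute_diag _ _).eq, diag_comp_mul_diag, sub_self, zero_mul]
    · rw [ih h, mul_zero]

theorem cutDown_mul_diag_comp_of_MCE_eq_empty {μ : Mor C} {l : List (MorTo μ.dom)}
    {β : MorTo μ.dom} (h : ∀ α ∈ l, Λ.MCE β.1 α.1 = ∅) :
    σ.cutDown μ l * σ (Balanced.diag Λ (μ.comp β.1 β.2)) =
      σ (Balanced.diag Λ (μ.comp β.1 β.2)) := by
  have h1 : σ (Balanced.diag Λ μ) * σ (Balanced.diag Λ (μ.comp β.1 β.2)) =
      σ (Balanced.diag Λ (μ.comp β.1 β.2)) := by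
    rw [(σ.commute_diag _ _).eq, diag_comp_mul_diag]
  induction l with
  | nil => exact h1
  | cons α l ih =>
    rw [cutDown, mul_assoc, ih fun α hα => h α (List.mem_cons_of_mem _ hα), gap, sub_mul, h1,
      diag_comp_mul_diag_comp_of_MCE_eq_empty (h α List.mem_cons_self), sub_zero]

/-- A path `β` without minimal common extensions with members of `E` would make `σ_{μβ,μβ}` a
multiple of the product, hence killed by `φ`. -/
theorem exhaustive_of_map_cutDown_eq_zero {D : Type*} [NonUnitalCStarAlgebra D]
    (φ : A →⋆ₙₐ[ℂ] D) (hφ : ∀ μ, φ (σ (Balanced.diag Λ μ)) ≠ 0) {μ : Mor C}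
    {E : Finset (MorTo μ.dom)} (h : φ (σ.cutDown μ E.toList) = 0) :
    Λ.Exhaustive (E : Set (MorTo μ.dom)) := by
  intro β
  by_contra! hβ
  refine hφ (μ.comp β.1 β.2) ?_
  rw [← cutDown_mul_diag_comp_of_MCE_eq_empty (l := E.toList) (β := β)
    fun α hα => hβ α (by simpa using hα), map_mul, h, zero_mul]

/-- The elements strictly above `p`. -/
def _root_.LeftLE.above (P : Submonoid G) (p : G) : Set G := {q | LeftLE P p q ∧ q ≠ p}

theorem _root_.LeftLE.mem_above {p q r : G} (h : q ∈ LeftLE.above P p) (h' : LeftLE P q r) :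
    r ∈ LeftLE.above P p :=
  ⟨h.1.trans h', fun e => h.2 (LeftLE.antisymm (e ▸ h') h.1)⟩

/-- Expanding the product one gap at a time, each correction starts with some `σ_{μα,μα}` of degree
strictly above `d(μ)`. -/
theorem diag_sub_cutDown_mem [Λ.FinitelyAligned] {F : Set (Mor C)} (hF : Λ.MCEClosed F)
    (hfin : F.Finite) {μ : Mor C} (hμ : μ ∈ F) (l : List (MorTo μ.dom))
    (hl : ∀ α ∈ l, α ∈ properExt Λ hfin μ) :
    σ (Balanced.diag Λ μ) - σ.cutDown μ l ∈ σ.gradedSpan F (LeftLE.above P (Λ.deg μ : G)) := by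
  induction l with
  | nil => simp [cutDown]
  | cons α l ih =>
    have h1 := ih fun α hα => hl α (List.mem_cons_of_mem _ hα)
    have hμ' : σ (Balanced.diag Λ μ) ∈ σ.gradedSpan F Set.univ := mem_gradedSpan hμ hμ (Set.mem_univ _)
    have h2 : σ.cutDown μ l ∈ σ.gradedSpan F Set.univ := by
      have := Submodule.sub_mem _ hμ' (gradedSpan_mono (fun _ _ _ => Set.mem_univ _) h1)
      rwa [sub_sub_cancel] at this
    have hα := mem_properExt.1 (hl α List.mem_cons_self)
    have h3 : σ (Balanced.diag Λ (μ.comp α.1 α.2)) ∈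
        σ.gradedSpan F (LeftLE.above P (Λ.deg μ : G)) := by
      refine mem_gradedSpan hα.1 hα.1 ⟨Λ.le_deg_comp _ _ _, fun h => hα.2 ?_⟩
      simpa [Balanced.diag, deg_comp] using h
    have h4 : σ (Balanced.diag Λ μ) - σ.cutDown μ (α :: l) =
        (σ (Balanced.diag Λ μ) - σ.cutDown μ l) +
          σ (Balanced.diag Λ (μ.comp α.1 α.2)) * σ.cutDown μ l := by
      rw [cutDown, gap, sub_mul, ← (commute_cutDown_diag μ l μ).eq, cutDown_mul_diag]
      abel
    rw [h4]
    exact Submodule.add_mem _ h1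
      (gradedSpan_mul_mem_left hF (fun p hp lam _ h => LeftLE.mem_above hp h) h3 h2)

/-- The product `σ_{μ,μ} σ_{λ,λ}`, with `λ` the first path of `z`, is a sum of `σ_{μα,μα}` with `μα
∈ F`. The degree condition excludes `d(α) = 1`, so a gap factor kills each term. -/
theorem cutDown_mul_apply [Λ.FinitelyAligned] {F : Set (Mor C)} (hF : Λ.MCEClosed F)
    (hfin : F.Finite) {μ : Mor C} (hμ : μ ∈ F) {z : Λ.Balanced} (hz : z.fst ∈ F)
    (hne : z.fst ≠ μ)
    (hd : LeftLE P (Λ.deg z.fst : G) (Λ.deg μ : G) → (Λ.deg z.fst : G) = Λ.deg μ) :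
    σ.cutDown μ (properExt Λ hfin μ).toList * σ z = 0 := by
  have key : ∀ e : Λ.MinExt μ z.fst, σ.cutDown μ (properExt Λ hfin μ).toList *
      σ ((Balanced.diag Λ μ).extend (Balanced.diag Λ z.fst) e) = 0 := by
    intro e
    have h1 : (Balanced.diag Λ μ).extend (Balanced.diag Λ z.fst) e =
        Balanced.diag Λ (μ.comp e.α e.hα) := Balanced.ext rfl e.eq.symm
    have h2 : (⟨e.α, e.hα⟩ : MorTo μ.dom) ∈ (properExt Λ hfin μ).toList := by
      refine Finset.mem_toList.2 (mem_properExt.2 ?_)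
      refine ⟨hF μ hμ μ hμ z.fst hz rfl rfl e, fun h => hne ?_⟩
      have h3 : μ.comp e.α e.hα = μ := Λ.comp_eq_self _ (by rw [deg_comp, h, mul_one])
      have h4 : z.fst.comp e.β e.hβ = μ := e.eq.symm.trans h3
      have h5 := hd (h4 ▸ Λ.le_deg_comp z.fst e.β e.hβ)
      rw [← Λ.comp_eq_self e.hβ (Subtype.ext (by rw [h4, h5])), h4]
    rw [h1]
    exact cutDown_mul_diag_comp h2
  have h0 : σ (Balanced.diag Λ μ) * σ (Balanced.diag Λ z.fst) ∈ LinearMap.ker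
      (LinearMap.mulLeft ℂ (σ.cutDown μ (properExt Λ hfin μ).toList)) :=
    apply_mul_apply_mem _ key
  have h1 : σ.cutDown μ (properExt Λ hfin μ).toList *
      (σ (Balanced.diag Λ μ) * σ (Balanced.diag Λ z.fst)) = 0 := h0
  rw [← σ.diag_mul z, ← cutDown_mul_diag, mul_assoc, ← mul_assoc (σ (Balanced.diag Λ μ)),
    ← mul_assoc, h1, zero_mul]

/-- An element of the kernel of `φ` in the span of the `σ_{μ,ν}` with `μ, ν ∈ F` is a combination
of multiples of gap products in the kernel of `φ`. -/
theorem mem_of_mem_gradedSpan [Λ.FinitelyAligned] {F : Set (Mor C)} (hF : Λ.MCEClosed F)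
    (hfin : F.Finite) {D : Type*} [NonUnitalCStarAlgebra D]
    (φ : A →⋆ₙₐ[ℂ] D) (hφ : ∀ μ, φ (σ (Balanced.diag Λ μ)) ≠ 0) (J : Submodule ℂ A)
    (hJ : ∀ x ∈ J, ∀ a, x * a ∈ J)
    (hgap : ∀ (μ : Mor C) (E : Finset (MorTo μ.dom)), Λ.Exhaustive (E : Set (MorTo μ.dom)) →
      φ (σ.gapProd μ E) = 0 → σ.gapProd μ E ∈ J)
    (U : Finset G)
    (hU : ∀ p ∈ U, ∀ lam ∈ F, LeftLE P p (Λ.deg lam : G) → (Λ.deg lam : G) ∈ U) {x : A}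
    (hx : x ∈ σ.gradedSpan F U) (hx0 : φ x = 0) : x ∈ J := by
  classical
  induction U using Finset.strongInduction generalizing x with
  | H U ih =>
  rcases U.eq_empty_or_nonempty with rfl | hne
  · have : x = 0 := by simpa [gradedSpan] using hx
    exact this ▸ J.zero_mem
  obtain ⟨p, hpU, hmin⟩ := LeftLE.exists_minimal (P := P) hne
  let Q (μ : Mor C) : A := σ.cutDown μ (properExt Λ hfin μ).toList
  have hQJ : ∀ μ, φ (Q μ) = 0 → Q μ ∈ J := by
    intro μ h
    have hE := exhaustive_of_map_cutDown_eq_zero φ hφ h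
    have heq : σ.gapProd μ (properExt Λ hfin μ) = Q μ :=
      gapProd_eq_cutDown (PGraph.Exhaustive.nonempty hE)
    exact heq ▸ hgap μ _ hE ((congrArg φ heq).trans h)
  let Z : Set Λ.Balanced := {z | z.fst ∈ F ∧ z.snd ∈ F ∧ (Λ.deg z.fst : G) ∈ ({p} : Set G)}
  have hZ : Finite Z := ((finite_balanced hfin).subset fun z hz => ⟨hz.1, hz.2.1⟩).to_subtype
  have := Fintype.ofFinite Z
  have hUp : ∀ q ∈ U.erase p, ∀ lam ∈ F, LeftLE P q (Λ.deg lam : G) →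
      (Λ.deg lam : G) ∈ U.erase p := by
    intro q hq lam hlam h
    rw [Finset.mem_erase] at hq ⊢
    exact ⟨fun e => hq.1 (hmin q hq.2 (e ▸ h)), hU q hq.2 lam hlam h⟩
  have hsplit : x ∈ σ.gradedSpan F {p} ⊔ σ.gradedSpan F (U.erase p : Finset G) := by
    rw [gradedSpan, gradedSpan, ← Submodule.span_union, ← Set.image_union]
    refine Submodule.span_mono (Set.image_mono ?_) hx
    rintro z ⟨h1, h2, h3⟩
    by_cases h : (Λ.deg z.fst : G) = p
    · exact Or.inl ⟨h1, h2, h⟩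
    · exact Or.inr ⟨h1, h2, Finset.mem_erase.2 ⟨h, h3⟩⟩
  obtain ⟨y, hy, z, hz, rfl⟩ := Submodule.mem_sup.1 hsplit
  have hy' : y ∈ Submodule.span ℂ (Set.range fun i : Z => σ i) := by
    rwa [← Set.image_eq_range]
  obtain ⟨c, rfl⟩ := (Submodule.mem_span_range_iff_exists_fun ℂ).1 hy'
  have hQz : ∀ i : Z, Q i.1.fst * z = 0 := by
    intro i
    have hle : σ.gradedSpan F (U.erase p : Finset G) ≤
        LinearMap.ker (LinearMap.mulLeft ℂ (Q i.1.fst)) := by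
      refine Submodule.span_le.2 ?_
      rintro _ ⟨a, ⟨h1, -, h3⟩, rfl⟩
      have h3' := Finset.mem_erase.1 (Finset.mem_coe.1 h3)
      have hi : (Λ.deg i.1.fst : G) = p := i.2.2.2
      refine cutDown_mul_apply hF hfin i.2.1 h1 (fun e => h3'.1 (e ▸ hi)) fun h => ?_
      rw [hi] at h ⊢
      exact hmin _ h3'.2 h
    exact hle hz
  -- Coefficient extraction: `Q` removes the terms with another first path, and `σ i.1.swap` those
  -- with the same first path but another second one.
  have hzero : ∀ i : Z, c i • Q i.1.fst = (Q i.1.fst * (∑ j, c j • σ j + z)) * σ i.1.swap := by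
    intro i
    rw [mul_add, hQz i, add_zero, Finset.mul_sum, Finset.sum_mul, Finset.sum_eq_single i]
    · rw [mul_smul_comm, smul_mul_assoc, mul_assoc, mul_swap_self, cutDown_mul_diag]
    · intro j _ hji
      rw [mul_smul_comm, smul_mul_assoc]
      have hi : (Λ.deg i.1.fst : G) = p := i.2.2.2
      have hj : (Λ.deg j.1.fst : G) = p := j.2.2.2
      by_cases h : j.1.fst = i.1.fst
      · have hs : j.1.snd ≠ i.1.swap.fst := fun h' => hji (Subtype.ext (Balanced.ext h h'))
        rw [mul_assoc, mul_eq_zero_of_deg_eq ?_ hs, mul_zero, smul_zero]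
        exact j.1.deg_eq.symm.trans ((Subtype.ext (hj.trans hi.symm)).trans i.1.deg_eq)
      · rw [cutDown_mul_apply hF hfin i.2.1 j.2.1 h fun _ => hj.trans hi.symm, zero_mul,
          smul_zero]
    · exact fun h => absurd (Finset.mem_univ i) h
  have hcQ : ∀ i : Z, φ (c i • Q i.1.fst) = 0 := by
    intro i
    rw [hzero i, map_mul, map_mul, hx0, mul_zero, zero_mul]
  have hcQJ : ∀ i : Z, c i • Q i.1.fst ∈ J := by
    intro i
    by_cases h : c i = 0
    · rw [h, zero_smul]
      exact J.zero_mem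
    · refine J.smul_mem _ (hQJ _ ?_)
      have := hcQ i
      rw [map_smul] at this
      exact (smul_eq_zero.1 this).resolve_left h
  -- Cutting down costs only terms of degree strictly above `p`, which the induction hypothesis
  -- covers.
  have hrest : ∀ i : Z, σ i - Q i.1.fst * σ i ∈ σ.gradedSpan F (U.erase p : Finset G) := by
    intro i
    have hi : (Λ.deg i.1.fst : G) = p := i.2.2.2
    have h1 := diag_sub_cutDown_mem (σ := σ) hF hfin i.2.1 (properExt Λ hfin i.1.fst).toList
      fun α hα => by simpa using hα
    have h2 := gradedSpan_mul_mem_left hF (fun q hq lam _ h => LeftLE.mem_above hq h) h1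
      (mem_gradedSpan (z := i.1) i.2.1 i.2.2.1 (Set.mem_univ _))
    rw [sub_mul, diag_mul] at h2
    refine gradedSpan_mono (fun lam hlam h => ?_) h2
    rw [hi] at h
    exact Finset.mem_coe.2 (Finset.mem_erase.2 ⟨h.2, hU p hpU lam hlam h.1⟩)
  have hsum : ∑ j, c j • σ j + z =
      (∑ j, c j • (σ j - Q j.1.fst * σ j) + z) + ∑ j, (c j • Q j.1.fst) * σ j := by
    simp only [smul_sub, Finset.sum_sub_distrib, smul_mul_assoc]
    abel
  have hlast : ∑ j, (c j • Q j.1.fst) * σ j ∈ J := J.sum_mem fun j _ => hJ _ (hcQJ j) _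
  rw [hsum]
  refine J.add_mem (ih _ (Finset.erase_ssubset hpU) hUp ?_ ?_) hlast
  · exact Submodule.add_mem _ (Submodule.sum_mem _ fun j _ => Submodule.smul_mem _ _ (hrest j)) hz
  · have h0 : φ (∑ j, (c j • Q j.1.fst) * σ j) = 0 := by
      rw [map_sum]
      exact Finset.sum_eq_zero fun j _ => by rw [map_mul, hcQ, zero_mul]
    rw [hsum, map_add, h0, add_zero] at hx0
    exact hx0

end

end Representation

end PGraph

/-! ### Closed ideals, density of the span, and the conclusion. -/

namespace PGraph

theorem isClosed_closedIdeal {A : Type*} [NonUnitalCStarAlgebra A] (S : Set A) :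
    IsClosed (closedIdeal S : Set A) := by
  rw [closedIdeal, Submodule.coe_sInf]
  exact isClosed_biInter fun I hI => hI.1

theorem subset_closedIdeal {A : Type*} [NonUnitalCStarAlgebra A] (S : Set A) :
    S ⊆ closedIdeal S := fun _ hx =>
  (Submodule.mem_sInf).2 fun _ hI => hI.2.1 hx

theorem mul_mem_closedIdeal {A : Type*} [NonUnitalCStarAlgebra A] {S : Set A} {x : A}
    (hx : x ∈ closedIdeal S) (a : A) : x * a ∈ closedIdeal S :=
  (Submodule.mem_sInf).2 fun I hI => (hI.2.2 a x ((Submodule.mem_sInf).1 hx I hI)).2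

theorem map_eq_zero_of_mem_closedIdeal {A D : Type*} [NonUnitalCStarAlgebra A]
    [NonUnitalCStarAlgebra D] (φ : A →⋆ₙₐ[ℂ] D) {S : Set A} (hS : ∀ x ∈ S, φ x = 0) {x : A}
    (hx : x ∈ closedIdeal S) : φ x = 0 := by
  have hφc : Continuous φ := AddMonoidHomClass.continuous_of_bound φ 1 fun y => by
    simpa using NonUnitalStarAlgHom.norm_apply_le φ y
  refine (Submodule.mem_sInf).1 hx (LinearMap.ker (φ : A →ₗ[ℂ] D)) ⟨?_, hS, ?_⟩
  · exact isClosed_singleton.preimage hφc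
  · intro a y hy
    have hy' : φ y = 0 := hy
    exact ⟨show φ (a * y) = 0 by rw [map_mul, hy', mul_zero],
      show φ (y * a) = 0 by rw [map_mul, hy', zero_mul]⟩

theorem map_listProd {A D : Type*} [NonUnitalCStarAlgebra A] [NonUnitalCStarAlgebra D]
    (φ : A →⋆ₙₐ[ℂ] D) (l : List A) : φ (listProd l) = listProd (l.map φ) := by
  induction l with
  | nil => exact map_zero φ
  | cons a l ih =>
    cases l with
    | nil => rfl
    | cons b l => exact (map_mul φ _ _).trans (congrArg (φ a * ·) ih)

variable {G : Type*} [Group G] {P : Submonoid G} {C : Type u} [Category.{v} C] {Λ : PGraph P C}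

namespace Representation

variable {A D : Type*} [NonUnitalCStarAlgebra A] [NonUnitalCStarAlgebra D]

theorem map_gapProd {σ : Λ.Representation A} {τ : Λ.Representation D} (φ : A →⋆ₙₐ[ℂ] D)
    (h : ∀ z, φ (σ z) = τ z) (μ : Mor C) (E : Finset (MorTo μ.dom)) :
    φ (σ.gapProd μ E) = τ.gapProd μ E := by
  rw [gapProd, gapProd, map_listProd, List.map_map]
  congr 2
  funext α
  simp [gap, h]

/-- The kernel of a homomorphism that is nonzero on the `σ_{μ,μ}` is generated by gap products. -/
theorem map_eq_zero_iff_mem_closedIdeal [IsQuasiLatticeOrdered P] [Λ.FinitelyAligned]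
    (σ : Λ.Representation A) (hσ : Dense (Submodule.span ℂ (Set.range σ) : Set A))
    (φ : A →⋆ₙₐ[ℂ] D) (hφ : ∀ μ, φ (σ (Balanced.diag Λ μ)) ≠ 0) (x : A) :
    φ x = 0 ↔ x ∈ closedIdeal (⋃ μ : Mor C, {y : A | ∃ E : Finset (MorTo μ.dom),
      Λ.Exhaustive (E : Set (MorTo μ.dom)) ∧ φ (σ.gapProd μ E) = 0 ∧ y = σ.gapProd μ E}) := by
  classical
  constructor
  · refine mem_of_map_eq_zero_of_dense φ _ (isClosed_closedIdeal _) fun x ε hε => ?_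
    obtain ⟨a, ha, hxa⟩ := Metric.mem_closure_iff.1 (hσ x) ε hε
    rw [dist_eq_norm] at hxa
    obtain ⟨T, hT, haT⟩ := Submodule.mem_span_finite_of_mem_span ha
    choose f hf using fun t : T => hT t.2
    let Z : Set Λ.Balanced := Set.range f
    have hZfin : Z.Finite := Set.finite_range f
    have hZ : (T : Set A) ⊆ σ '' Z := fun t ht => ⟨_, ⟨⟨t, ht⟩, rfl⟩, hf ⟨t, ht⟩⟩
    obtain ⟨F, hfin, hZF, hF⟩ := Λ.exists_finite_MCEClosed
      ((hZfin.image Balanced.fst).union (hZfin.image Balanced.snd))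
    refine ⟨σ.gradedSubalgebra hF, isClosed_gradedSubalgebra hF hfin, fun y hy hy0 => ?_, a, ?_,
      hxa⟩
    · let U : Finset G := (hfin.image fun lam => (Λ.deg lam : G)).toFinset
      have hU : ∀ lam ∈ F, (Λ.deg lam : G) ∈ U := fun lam hlam =>
        (Set.Finite.mem_toFinset _).2 ⟨lam, hlam, rfl⟩
      have hy' : y ∈ σ.gradedSpan F U :=
        gradedSpan_mono (fun lam hlam _ => Finset.mem_coe.2 (hU lam hlam))
          (show y ∈ σ.gradedSpan F Set.univ from hy)
      refine mem_of_mem_gradedSpan hF hfin φ hφ _ (fun x hx a => mul_mem_closedIdeal hx a)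
        (fun μ E hE h0 => subset_closedIdeal _ ?_) U (fun _ _ lam hlam _ => hU lam hlam) hy' hy0
      exact Set.mem_iUnion.2 ⟨μ, E, hE, h0, rfl⟩
    · have : Submodule.span ℂ (T : Set A) ≤ σ.gradedSpan F Set.univ := by
        exact Submodule.span_mono (hZ.trans (Set.image_mono fun z hz =>
          ⟨hZF (Or.inl ⟨z, hz, rfl⟩), hZF (Or.inr ⟨z, hz, rfl⟩), Set.mem_univ _⟩))
      exact this haT
  · refine map_eq_zero_of_mem_closedIdeal φ fun y hy => ?_
    obtain ⟨μ, E, -, h0, rfl⟩ := Set.mem_iUnion.1 hy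
    exact h0

theorem mul_mem_span_range [Λ.FinitelyAligned] (σ : Λ.Representation A) {x y : A}
    (hx : x ∈ Submodule.span ℂ (Set.range σ)) (hy : y ∈ Submodule.span ℂ (Set.range σ)) :
    x * y ∈ Submodule.span ℂ (Set.range σ) := by
  refine Submodule.mul_mem_of_mem_span ?_ hx hy
  rintro _ ⟨a, rfl⟩ _ ⟨b, rfl⟩
  exact apply_mul_apply_mem _ fun e => Submodule.subset_span ⟨_, rfl⟩

theorem star_mem_span_range (σ : Λ.Representation A) {x : A}
    (hx : x ∈ Submodule.span ℂ (Set.range σ)) : star x ∈ Submodule.span ℂ (Set.range σ) := by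
  induction hx using Submodule.span_induction with
  | zero => simp
  | add a b _ _ ha hb => rw [star_add]; exact Submodule.add_mem _ ha hb
  | smul c a _ ha => rw [star_smul]; exact Submodule.smul_mem _ _ ha
  | mem a ha =>
    obtain ⟨z, rfl⟩ := ha
    rw [σ.star_eq]
    exact Submodule.subset_span ⟨_, rfl⟩

/-- The star subalgebra spanned by the range of a representation. -/
def spanRange [Λ.FinitelyAligned] (σ : Λ.Representation A) : NonUnitalStarSubalgebra ℂ A where
  carrier := Submodule.span ℂ (Set.range σ)
  add_mem' := Submodule.add_mem _
  zero_mem' := Submodule.zero_mem _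
  smul_mem' := fun c _ => Submodule.smul_mem _ c
  mul_mem' := σ.mul_mem_span_range
  star_mem' := σ.star_mem_span_range

end Representation

theorem dense_span_range_omega [IsQuasiLatticeOrdered P] [Λ.FinitelyAligned] :
    Dense (Submodule.span ℂ (Set.range (omega.{w} Λ)) : Set (BalAlg.{w} Λ)) := by
  have hle : NonUnitalStarAlgebra.adjoin ℂ (Set.range (genProduct.{w} Λ)) ≤
      (omega.{w} Λ).spanRange.map (NonUnitalStarSubalgebraClass.subtype
        (cstarGenerated (Set.range (genProduct.{w} Λ)))) := by
    refine NonUnitalStarAlgebra.adjoin_le ?_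
    rintro _ ⟨z, rfl⟩
    exact ⟨omega Λ z, Submodule.subset_span ⟨z, rfl⟩, rfl⟩
  intro x
  rw [Topology.IsInducing.subtypeVal.closure_eq_preimage_closure_image]
  exact closure_mono (fun y hy => hle hy) x.2

end PGraph

theorem mainTheorem3 {G : Type*} [Group G] (P : Submonoid G)
    [IsQuasiLatticeOrdered P] {C : Type u} [Category.{v} C]
    (Λ : PGraph P C) [Λ.FinitelyAligned]
    {B : Type w} [NonUnitalCStarAlgebra B] (τ : Λ.Representation B)
    (hτ : ∀ μ : Mor C, τ (PGraph.Balanced.diag Λ μ) ≠ 0) :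
    {x : PGraph.BalAlg.{w} Λ | Λ.rho τ x = 0} =
      (closedIdeal
        (⋃ μ : Mor C, {y : PGraph.BalAlg.{w} Λ | ∃ E : Finset (MorTo μ.dom),
          Λ.Exhaustive (E : Set (MorTo μ.dom)) ∧ τ.gapProd μ E = 0 ∧
          y = (PGraph.omega.{w} Λ).gapProd μ E}) : Set (PGraph.BalAlg.{w} Λ)) := by
  -- Composing with the injective inclusion into `B` leaves the kernel unchanged.
  let φ : PGraph.BalAlg.{w} Λ →⋆ₙₐ[ℂ] B :=
    (NonUnitalStarSubalgebraClass.subtype (cstarGenerated (Set.range τ))).comp (Λ.rho τ)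
  have hφ : ∀ z, φ (Λ.omega z) = τ z := fun _ => rfl
  ext x
  have h := (PGraph.omega.{w} Λ).map_eq_zero_iff_mem_closedIdeal PGraph.dense_span_range_omega φ hτ x
  simp only [PGraph.Representation.map_gapProd φ hφ] at h
  exact Subtype.ext_iff.trans h
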